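/- Let $\Omega \subset \mathbb{R}^d$ be convex and compact with Lebesgue-negligible boundary, let $\mathcal{P}(\Omega)$ be the set of Borel probability measures on $\Omega$ with the topology of weak convergence, let $\mathcal{F}$ be a non-empty compact topological space, let $\mathcal{L} : \mathcal{F} \times \mathcal{P}(\Omega) \to [0, \infty)$ be continuous, let $\tau > 0$, and let $\rho \in \mathcal{P}(\Omega)$ be absolutely continuous with respect to Lebesgue measure. For $\alpha, \beta \in \mathcal{P}(\Omega)$ let $W_2^2(\alpha, \beta) = \inf_\gamma \int_{\Omega \times \Omega} \|x - y\|^2 \, d\gamma(x,y)$, where $\gamma$ ranges over the probability measures on $\Omega \times \Omega$ with marginals $\alpha$ and $\beta$. A Borel map $T : \Omega \to \Omega$ is called an optimal transport map from $\alpha$ to $\beta$ if $T_\sharp \alpha = \beta$, if $\int_\Omega \|T(x) - x\|^2 \, d\alpha(x)$ is least among all Borel maps $\Omega \to \Omega$ pushing $\alpha$ to $\beta$, and if its value is $W_2^2(\alpha, \beta)$. (Static problem) Consider the problem of minimizing, over all Borel maps $T : \Omega \to \Omega$ and all $F \in \mathcal{F}$, $$\mathcal{L}(F, T_\sharp \rho)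 + \frac{1}{2\tau} \int_\Omega \|T(x) - x\|^2 \, d\rho(x).$$ It has a minimizer $(T, F)$ such that $T$ is an optimal transport map from $\rho$ to $T_\sharp \rho$; and for every minimizer $(T, F)$, $T$ is an optimal transport map from $\rho$ to $T_\sharp \rho$. (Dynamic problem) Consider the problem of minimizing $$\mathcal{L}(F, T_\sharp \rho) + \frac{1}{2\tau} \int_0^1 \|v_t\|^2_{L^2((\phi_t)_\sharp \rho)} \, dt, \qquad T = \phi_1,$$ over all $F \in \mathcal{F}$, all Borel time-dependent velocity fields $(t,x) \mapsto v_t(x)$ on $\mathbb{R}^d$, and all flows $\phi$ of $v$ started on $\Omega$, i.e. Borel maps $(t,x) \mapsto \phi_t(x) \in \mathbb{R}^d$ (for $x \in \Omega$) such that for $\rho$-almost every $x$ the function $s \mapsto v_s(\phi_s(x))$ is integrable on $[0,1]$ and $\phi_t(x) = x + \int_0^t v_s(\phi_s(x)) \, ds$ for all $t \in [0,1]$, and such that $\phi_1(\Omega) \subset \Omega$. It has a minimizer $(v, \phi, F)$ such that $T = \phi_1$ is an optimal transport map from $\rho$ to $T_\sharp \rho$; and for every minimizer $(v, \phi, F)$,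 $T = \phi_1$ is an optimal transport map from $\rho$ to $T_\sharp \rho$. -/

import Mathlib

open MeasureTheory
open scoped ENNReal

noncomputable section

namespace ModuleWise

/-- The Euclidean space `ℝ^d`. -/
abbrev Eucl (d : ℕ) : Type := EuclideanSpace ℝ (Fin d)

variable {d : ℕ} {Ω : Set (Eucl d)}

/-- Borel maps `T : Ω → Ω`. -/
abbrev BorelMap (Ω : Set (Eucl d)) : Type := {T : Ω → Ω // Measurable T}

/-- The push-forward `T_♯ α` of a probability measure on `Ω` under a Borel map `T : Ω → Ω`. -/
def push (T : BorelMap Ω) (α : ProbabilityMeasure Ω) : ProbabilityMeasure Ω :=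
  α.map T.2.aemeasurable

/-- The quadratic transport cost `∫_Ω ‖T x - x‖² dα(x)` of a map. -/
def mapCost (α : ProbabilityMeasure Ω) (T : BorelMap Ω) : ℝ :=
  ∫ x, ‖(T.1 x : Eucl d) - (x : Eucl d)‖ ^ 2 ∂(α : Measure Ω)

/-- The set `Π(α, β)` of probability measures on `Ω × Ω` with marginals `α` and `β`. -/
def couplings (α β : ProbabilityMeasure Ω) : Set (ProbabilityMeasure (Ω × Ω)) :=
  {γ | (γ : Measure (Ω × Ω)).map Prod.fst = (α : Measure Ω) ∧
    (γ : Measure (Ω × Ω)).map Prod.snd = (β : Measure Ω)}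

/-- The quadratic transport cost `∫_{Ω × Ω} ‖x - y‖² dγ(x, y)` of a plan. -/
def planCost (γ : ProbabilityMeasure (Ω × Ω)) : ℝ :=
  ∫ p, ‖(p.1 : Eucl d) - (p.2 : Eucl d)‖ ^ 2 ∂(γ : Measure (Ω × Ω))

/-- The squared Wasserstein distance `W₂²(α, β)`: the infimum of the cost over all plans. -/
def wassersteinSq (α β : ProbabilityMeasure Ω) : ℝ :=
  sInf (planCost '' couplings α β)

/-- `T` is an optimal transport map from `α` to `β` for the cost `‖x - y‖²`: it pushes `α` to `β`,
it has the least cost among all such maps, and its cost is `W₂²(α, β)`. -/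
def IsOptimalTransportMap (α β : ProbabilityMeasure Ω) (T : BorelMap Ω) : Prop :=
  push T α = β ∧
  (∀ S : BorelMap Ω, push S α = β → mapCost α T ≤ mapCost α S) ∧
  mapCost α T = wassersteinSq α β

variable {𝓕 : Type*}

/-- The objective `𝓛(F, T_♯ ρ) + (1 / 2τ) ∫_Ω ‖T x - x‖² dρ(x)`. -/
def objective (𝓛 : 𝓕 → ProbabilityMeasure Ω → ℝ) (τ : ℝ) (ρ : ProbabilityMeasure Ω)
    (T : BorelMap Ω) (F : 𝓕) : ℝ :=
  𝓛 F (push T ρ) + 1 / (2 * τ) * mapCost ρ T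

/-- `(T, F)` minimizes the objective over all Borel maps `Ω → Ω` and all elements of `𝓕`. -/
def IsMinimizer (𝓛 : 𝓕 → ProbabilityMeasure Ω → ℝ) (τ : ℝ) (ρ : ProbabilityMeasure Ω)
    (T : BorelMap Ω) (F : 𝓕) : Prop :=
  ∀ (S : BorelMap Ω) (G : 𝓕), objective 𝓛 τ ρ T F ≤ objective 𝓛 τ ρ S G

/-- A competitor of the dynamic problem: a Borel time-dependent velocity field `v` on `ℝ^d`, a flow
`φ` of `v` started on `Ω`, and the time-one map `T` of the flow, which has to map `Ω` to `Ω`.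
The equations `∂ₜ φₜ(x) = vₜ(φₜ(x))`, `φ₀(x) = x` hold in the sense of Carathéodory (absolutely
continuous solutions, in integral form), for `ρ`-almost every starting point `x`. -/
structure FlowCompetitor (ρ : ProbabilityMeasure Ω) where
  /-- the velocity field -/
  v : ℝ → Eucl d → Eucl d
  /-- the flow -/
  φ : ℝ → Ω → Eucl d
  /-- the time-one map -/
  T : BorelMap Ω
  measurable_v : Measurable (Function.uncurry v)
  measurable_φ : Measurable (Function.uncurry φ)
  integrable : ∀ᵐ x ∂(ρ : Measure Ω), IntervalIntegrable (fun s => v s (φ s x)) volume 0 1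
  flow : ∀ᵐ x ∂(ρ : Measure Ω), ∀ t ∈ Set.Icc (0 : ℝ) 1,
    φ t x = (x : Eucl d) + ∫ s in (0 : ℝ)..t, v s (φ s x)
  time_one : ∀ x : Ω, (T.1 x : Eucl d) = φ 1 x

/-- The kinetic energy `∫₀¹ ‖vₜ‖²_{L²((φₜ)_♯ ρ)} dt`, a number in `[0, ∞]`. -/
def FlowCompetitor.energy {ρ : ProbabilityMeasure Ω} (c : FlowCompetitor ρ) : ℝ≥0∞ :=
  ∫⁻ t in Set.Icc (0 : ℝ) 1, ∫⁻ y, ‖c.v t y‖ₑ ^ 2 ∂((ρ : Measure Ω).map (c.φ t))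

/-- The dynamic objective `𝓛(F, T_♯ ρ) + (1 / 2τ) ∫₀¹ ‖vₜ‖²_{L²((φₜ)_♯ ρ)} dt` in `[0, ∞]`,
for a non-negative loss `𝓛`. -/
def dynObjective (𝓛 : 𝓕 → ProbabilityMeasure Ω → ℝ) (τ : ℝ) {ρ : ProbabilityMeasure Ω}
    (c : FlowCompetitor ρ) (F : 𝓕) : ℝ≥0∞ :=
  ENNReal.ofReal (𝓛 F (push c.T ρ)) + ENNReal.ofReal (1 / (2 * τ)) * c.energy

/-- `(c, F)` minimizes the dynamic objective over all velocity fields with their flows and all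
elements of `𝓕`. -/
def IsDynMinimizer (𝓛 : 𝓕 → ProbabilityMeasure Ω → ℝ) (τ : ℝ) {ρ : ProbabilityMeasure Ω}
    (c : FlowCompetitor ρ) (F : 𝓕) : Prop :=
  ∀ (c' : FlowCompetitor ρ) (G : 𝓕), dynObjective 𝓛 τ c F ≤ dynObjective 𝓛 τ c' G

end ModuleWise

end

noncomputable section

namespace ModuleWise

variable {d : ℕ} {Ω : Set (Eucl d)}

/-! For a fixed target `ν = T_♯ ρ` the loss is fixed, and both the transport cost and the kinetic
energy are at least `W₂²(ρ, ν)`. When `ρ` is absolutely continuous both bounds are attained, so each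
problem reduces to minimizing `𝓛(F, ν) + W₂²(ρ, ν) / 2τ`. A minimizer must then attain the bound for
its own target: otherwise a competitor with the same target does better.

Existence comes from compactness, by relaxing maps to plans (`exists_relaxed_minimizer`). Attainment
by a map is Brenier's theorem (`exists_monotone_map`), obtained without convex potentials:
exchanging endpoints shows that the support of an optimal plan is monotone
(`inner_nonneg_of_mem_support`), and a monotone closed set is multivalued only over a Lebesgue-null
set (`measure_multiSet`).

For the dynamic problem, Cauchy–Schwarz in time bounds the energy below by the cost
(`mapCost_le_energy`). Straight lines run at constant speed give equality; by monotonicity they do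
not meet before time one, so a velocity field generates them (`exists_optimal_flow`). -/

/-! ### Plans, induced plans and the Kantorovich problem. -/

/-- The quadratic cost as a function on `Ω × Ω`. -/
def sqCost (p : Ω × Ω) : ℝ := ‖(p.1 : Eucl d) - (p.2 : Eucl d)‖ ^ 2

lemma continuous_sqCost : Continuous (sqCost : Ω × Ω → ℝ) := by
  unfold sqCost; fun_prop

lemma sqCost_nonneg (p : Ω × Ω) : 0 ≤ sqCost p := by unfold sqCost; positivity

lemma planCost_eq (γ : ProbabilityMeasure (Ω × Ω)) :
    planCost γ = ∫ p, sqCost p ∂(γ : Measure (Ω × Ω)) := rfl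

lemma continuous_planCost [CompactSpace Ω] :
    Continuous (planCost : ProbabilityMeasure (Ω × Ω) → ℝ) :=
  ProbabilityMeasure.continuous_integral_continuousMap
    (⟨sqCost, continuous_sqCost⟩ : C(Ω × Ω, ℝ))

lemma planCost_nonneg (γ : ProbabilityMeasure (Ω × Ω)) : 0 ≤ planCost γ :=
  integral_nonneg sqCost_nonneg

lemma wassersteinSq_le {α β : ProbabilityMeasure Ω} {γ : ProbabilityMeasure (Ω × Ω)}
    (hγ : γ ∈ couplings α β) : wassersteinSq α β ≤ planCost γ :=
  csInf_le ⟨0, by rintro _ ⟨γ, -, rfl⟩; exact planCost_nonneg γ⟩ ⟨γ, hγ, rfl⟩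

/-- The plan `(id, T)_♯ α` induced by a map `T`. -/
def graphPlan (α : ProbabilityMeasure Ω) (T : BorelMap Ω) : ProbabilityMeasure (Ω × Ω) :=
  α.map (f := fun x => (x, T.1 x)) (measurable_id.prodMk T.2).aemeasurable

lemma graphPlan_mem_couplings (α : ProbabilityMeasure Ω) (T : BorelMap Ω) :
    graphPlan α T ∈ couplings α (push T α) := by
  have hT := T.2
  constructor
  · rw [graphPlan, ProbabilityMeasure.toMeasure_map, Measure.map_map measurable_fst (by fun_prop)]
    exact Measure.map_id
  · rw [graphPlan, ProbabilityMeasure.toMeasure_map, Measure.map_map measurable_snd (by fun_prop)]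
    rfl

lemma planCost_graphPlan (α : ProbabilityMeasure Ω) (T : BorelMap Ω) :
    planCost (graphPlan α T) = mapCost α T := by
  have hT := T.2
  rw [planCost_eq, graphPlan, ProbabilityMeasure.toMeasure_map, integral_map (by fun_prop)
    continuous_sqCost.aestronglyMeasurable]
  simp only [sqCost, mapCost, norm_sub_rev]

lemma wassersteinSq_le_mapCost (α : ProbabilityMeasure Ω) (T : BorelMap Ω) :
    wassersteinSq α (push T α) ≤ mapCost α T :=
  planCost_graphPlan α T ▸ wassersteinSq_le (graphPlan_mem_couplings α T)

/-- Every map with the same target induces a coupling, so `W₂²` bounds all their costs from below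
and attaining it gives both forms of optimality. -/
lemma isOptimalTransportMap_of_le {α : ProbabilityMeasure Ω} {T : BorelMap Ω}
    (h : mapCost α T ≤ wassersteinSq α (push T α)) :
    IsOptimalTransportMap α (push T α) T := by
  refine ⟨rfl, fun S hS => h.trans ?_, h.antisymm (wassersteinSq_le_mapCost α T)⟩
  rw [← hS]
  exact wassersteinSq_le_mapCost α S

lemma isClosed_couplings (α β : ProbabilityMeasure Ω) : IsClosed (couplings α β) := by
  have h1 : IsClosed {γ : ProbabilityMeasure (Ω × Ω) |
      γ.map (f := Prod.fst) measurable_fst.aemeasurable = α} :=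
    isClosed_eq (ProbabilityMeasure.continuous_map continuous_fst) continuous_const
  have h2 : IsClosed {γ : ProbabilityMeasure (Ω × Ω) |
      γ.map (f := Prod.snd) measurable_snd.aemeasurable = β} :=
    isClosed_eq (ProbabilityMeasure.continuous_map continuous_snd) continuous_const
  convert h1.inter h2 using 1
  ext γ
  simp only [couplings, Set.mem_ofPred_eq, Set.mem_inter_iff,
    ← ProbabilityMeasure.toMeasure_injective.eq_iff, ProbabilityMeasure.toMeasure_map]

lemma couplings_nonempty (α β : ProbabilityMeasure Ω) : (couplings α β).Nonempty :=
  ⟨α.prod β, by simp [couplings, ProbabilityMeasure.toMeasure_prod]⟩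

/-- The Kantorovich problem on a compact set has a solution. -/
lemma exists_optimal_plan [CompactSpace Ω] (α β : ProbabilityMeasure Ω) :
    ∃ γ ∈ couplings α β, (∀ γ' ∈ couplings α β, planCost γ ≤ planCost γ') ∧
      planCost γ = wassersteinSq α β := by
  obtain ⟨γ, hγ, hmin⟩ := (isClosed_couplings α β).isCompact.exists_isMinOn
    (couplings_nonempty α β) continuous_planCost.continuousOn
  refine ⟨γ, hγ, fun γ' h => hmin h, le_antisymm ?_ (wassersteinSq_le hγ)⟩
  exact le_csInf ((couplings_nonempty α β).image _) (by rintro _ ⟨γ', h, rfl⟩; exact hmin h)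

/-! ### Monotonicity of the support of an optimal plan. -/

/-- The change of the cost when the two pairs `p` and `q` exchange their second components. -/
def swapGain (z : (Ω × Ω) × (Ω × Ω)) : ℝ :=
  sqCost z.1 + sqCost z.2 - sqCost (z.1.1, z.2.2) - sqCost (z.2.1, z.1.2)

lemma continuous_swapGain : Continuous (swapGain : (Ω × Ω) × (Ω × Ω) → ℝ) := by
  have := continuous_sqCost (Ω := Ω)
  unfold swapGain; fun_prop

lemma swapGain_swap (z : (Ω × Ω) × (Ω × Ω)) : swapGain z.swap = swapGain z := by
  simp only [swapGain, Prod.fst_swap, Prod.snd_swap]; ring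

lemma swapGain_eq (z : (Ω × Ω) × (Ω × Ω)) : swapGain z =
    -2 * inner ℝ ((z.1.1 : Eucl d) - z.2.1) ((z.1.2 : Eucl d) - z.2.2) := by
  simp only [swapGain, sqCost, norm_sub_sq_real, inner_sub_left, inner_sub_right]
  ring

open Classical in
/-- Exchange the second components of two pairs when this lowers the cost, keep the first pair. -/
def swapMap (z : (Ω × Ω) × (Ω × Ω)) : Ω × Ω :=
  (z.1.1, if 0 < swapGain z then z.2.2 else z.1.2)

lemma measurableSet_swapGain_pos : MeasurableSet {z : (Ω × Ω) × (Ω × Ω) | 0 < swapGain z} :=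
  measurableSet_lt measurable_const continuous_swapGain.measurable

lemma measurable_swapMap : Measurable (swapMap : (Ω × Ω) × (Ω × Ω) → Ω × Ω) :=
  (by fun_prop : Measurable fun z : (Ω × Ω) × (Ω × Ω) => z.1.1).prodMk
    (Measurable.ite measurableSet_swapGain_pos (by fun_prop) (by fun_prop))

/-- First components never move. For the second marginal, the set where an exchange occurs and the
measure `γ ⊗ γ` are both invariant under swapping the two pairs, so on that set either second
component has the same law. -/
lemma swapMap_mem_couplings {α β : ProbabilityMeasure Ω} {γ : ProbabilityMeasure (Ω × Ω)}
    (hγ : γ ∈ couplings α β) :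
    (γ.prod γ).map measurable_swapMap.aemeasurable ∈ couplings α β := by
  classical
  set m : Measure ((Ω × Ω) × (Ω × Ω)) := (γ : Measure (Ω × Ω)).prod γ with hm
  have hfst : m.map Prod.fst = γ := by simp [hm]
  have hswap : m.map Prod.swap = m := Measure.prod_swap
  constructor
  · rw [ProbabilityMeasure.toMeasure_map, ProbabilityMeasure.toMeasure_prod,
      Measure.map_map measurable_fst measurable_swapMap]
    change m.map (Prod.fst ∘ Prod.fst) = _
    rw [← Measure.map_map measurable_fst measurable_fst, hfst, hγ.1]
  · rw [ProbabilityMeasure.toMeasure_map, ProbabilityMeasure.toMeasure_prod,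
      Measure.map_map measurable_snd measurable_swapMap]
    change m.map _ = _
    rw [← hγ.2]
    conv_rhs => rw [← hfst, Measure.map_map measurable_snd measurable_fst]
    ext B hB
    have hms := measurable_swapMap (Ω := Ω)
    rw [Measure.map_apply (measurable_snd.comp hms) hB, Measure.map_apply (by fun_prop) hB]
    set D : Set ((Ω × Ω) × (Ω × Ω)) := {z | 0 < swapGain z}
    have hD : MeasurableSet D := measurableSet_swapGain_pos
    rw [← measure_inter_add_sdiff _ hD, ← measure_inter_add_sdiff ((Prod.snd ∘ Prod.fst) ⁻¹' B) hD]
    congr 1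
    · conv_lhs => rw [← hswap]
      rw [Measure.map_apply measurable_swap
        (((measurable_snd.comp hms) hB).inter hD)]
      congr 1
      ext z
      simp only [D, Set.mem_preimage, Set.mem_inter_iff, Set.mem_ofPred_eq, swapGain_swap,
        Function.comp, swapMap]
      refine and_congr_left fun h => ?_
      simp [h]
    · congr 1
      ext z
      simp only [D, Set.mem_preimage, Set.mem_sdiff, Set.mem_ofPred_eq, Function.comp, swapMap]
      refine and_congr_left fun h => ?_
      simp [h]

/-- Exchanging second components almost never lowers the cost of an optimal plan. -/
lemma ae_swapGain_nonpos [CompactSpace Ω] {α β : ProbabilityMeasure Ω}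
    {γ : ProbabilityMeasure (Ω × Ω)} (hγ : γ ∈ couplings α β)
    (hmin : ∀ γ' ∈ couplings α β, planCost γ ≤ planCost γ') :
    ((γ : Measure (Ω × Ω)).prod γ) {z | 0 < swapGain z} = 0 := by
  classical
  have h0 := hmin _ (swapMap_mem_couplings hγ)
  set m : Measure ((Ω × Ω) × (Ω × Ω)) := (γ : Measure (Ω × Ω)).prod γ with hm
  set D : Set ((Ω × Ω) × (Ω × Ω)) := {z | 0 < swapGain z} with hDdef
  have hD : MeasurableSet D := measurableSet_swapGain_pos
  have hcs := continuous_sqCost (Ω := Ω)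
  have hint : ∀ f : (Ω × Ω) × (Ω × Ω) → ℝ, Continuous f → Integrable f m := fun f hf =>
    hf.integrable_of_hasCompactSupport (HasCompactSupport.of_compactSpace f)
  have hfst : m.map Prod.fst = γ := by simp [hm]
  have hswap : m.map Prod.swap = m := Measure.prod_swap
  rw [planCost_eq, planCost_eq, ProbabilityMeasure.toMeasure_map, ProbabilityMeasure.toMeasure_prod,
    integral_map measurable_swapMap.aemeasurable hcs.aestronglyMeasurable,
    ← hfst, integral_map measurable_fst.aemeasurable hcs.aestronglyMeasurable, hfst] at h0
  change ∫ z, sqCost z.1 ∂m ≤ ∫ z, sqCost (swapMap z) ∂m at h0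
  have h1 : ∀ z, sqCost (swapMap z) = sqCost z.1 +
      D.indicator (fun z => sqCost (z.1.1, z.2.2) - sqCost z.1) z := by
    intro z
    by_cases hz : 0 < swapGain z
    · simp [swapMap, hz, D]
    · simp [swapMap, hz, D]
  simp only [h1] at h0
  rw [integral_add (hint _ (by fun_prop)) ((hint _ (by fun_prop)).indicator hD),
    integral_indicator hD] at h0
  -- `swapMap` records only the first pair; by symmetry the second pair contributes the same change,
  -- and together they make up `-swapGain`.
  have h2 : ∫ z in D, (sqCost (z.1.1, z.2.2) - sqCost z.1) ∂m =
      ∫ z in D, (sqCost (z.2.1, z.1.2) - sqCost z.2) ∂m := by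
    rw [← integral_indicator hD, ← integral_indicator hD]
    conv_lhs => rw [← hswap]
    rw [integral_map measurable_swap.aemeasurable]
    · congr 1
      ext z
      simp only [Set.indicator, D, Set.mem_ofPred_eq, swapGain_swap, Prod.fst_swap, Prod.snd_swap]
    · exact ((Continuous.measurable (by fun_prop)).indicator hD).aestronglyMeasurable
  have h3 : ∫ z in D, swapGain z ∂m ≤ 0 := by
    have : ∫ z in D, swapGain z ∂m = -(∫ z in D, (sqCost (z.1.1, z.2.2) - sqCost z.1) ∂m +
      ∫ z in D, (sqCost (z.2.1, z.1.2) - sqCost z.2) ∂m) := by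
      rw [← integral_add (hint _ (by fun_prop)).integrableOn (hint _ (by fun_prop)).integrableOn,
        ← integral_neg]
      congr 1; ext z; simp only [swapGain]; ring
    rw [this]
    linarith
  by_contra hne
  have h4 : 0 < ∫ z in D, swapGain z ∂m := by
    rw [setIntegral_pos_iff_support_of_nonneg_ae]
    · have : Function.support swapGain ∩ D = D := by
        apply Set.inter_eq_right.2
        intro z hz
        exact ne_of_gt hz
      rw [this]
      exact pos_iff_ne_zero.2 hne
    · exact (ae_restrict_iff' hD).2 (.of_forall fun z hz => le_of_lt hz)
    · exact (hint _ continuous_swapGain).integrableOn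
  linarith

/-- The support of an optimal plan is a monotone set. -/
lemma inner_nonneg_of_mem_support [CompactSpace Ω] {α β : ProbabilityMeasure Ω}
    {γ : ProbabilityMeasure (Ω × Ω)} (hγ : γ ∈ couplings α β)
    (hmin : ∀ γ' ∈ couplings α β, planCost γ ≤ planCost γ')
    {p q : Ω × Ω} (hp : p ∈ (γ : Measure (Ω × Ω)).support)
    (hq : q ∈ (γ : Measure (Ω × Ω)).support) :
    0 ≤ inner ℝ ((p.1 : Eucl d) - q.1) ((p.2 : Eucl d) - q.2) := by
  by_contra! hlt
  have hpos : 0 < swapGain (p, q) := by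
    rw [swapGain_eq]
    simp only at hlt ⊢
    linarith
  have hopen : {z : (Ω × Ω) × (Ω × Ω) | 0 < swapGain z} ∈ nhds (p, q) :=
    (isOpen_lt continuous_const continuous_swapGain).mem_nhds hpos
  obtain ⟨U, hU, V, hV, hUV⟩ := mem_nhds_prod_iff.1 hopen
  rw [Measure.mem_support_iff_forall] at hp hq
  have h := measure_mono_null hUV (ae_swapGain_nonpos hγ hmin)
  rw [Measure.prod_prod] at h
  exact mul_ne_zero (hp U hU).ne' (hq V hV).ne' h

/-! ### Monotone closed sets are single-valued almost everywhere. -/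

/-- A subset of `Ω × Ω` is monotone as the graph of a multivalued map. -/
def MonotoneGraph (Γ : Set (Ω × Ω)) : Prop :=
  ∀ p ∈ Γ, ∀ q ∈ Γ, 0 ≤ inner ℝ ((p.1 : Eucl d) - q.1) ((p.2 : Eucl d) - q.2)

/-- The points at which the values of `Γ` have `i`-th coordinates both below `a` and above `b`. -/
def gapSet (Γ : Set (Ω × Ω)) (i : Fin d) (a b : ℝ) : Set Ω :=
  {x | ∃ y y' : Ω, (x, y) ∈ Γ ∧ (x, y') ∈ Γ ∧ (y : Eucl d) i ≤ a ∧ b ≤ (y' : Eucl d) i}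

lemma isClosed_gapSet [CompactSpace Ω] {Γ : Set (Ω × Ω)} (hΓ : IsClosed Γ) (i : Fin d) (a b : ℝ) :
    IsClosed (gapSet Γ i a b) := by
  have hK : IsClosed {z : Ω × Ω × Ω | (z.1, z.2.1) ∈ Γ ∧ (z.1, z.2.2) ∈ Γ ∧
      (z.2.1 : Eucl d) i ≤ a ∧ b ≤ (z.2.2 : Eucl d) i} :=
    (hΓ.preimage (by fun_prop : Continuous fun z : Ω × Ω × Ω => (z.1, z.2.1))).inter <|
      (hΓ.preimage (by fun_prop : Continuous fun z : Ω × Ω × Ω => (z.1, z.2.2))).inter <|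
      (isClosed_le (f := fun z : Ω × Ω × Ω => (z.2.1 : Eucl d) i) (by fun_prop)
        continuous_const).inter
      (isClosed_le (g := fun z : Ω × Ω × Ω => (z.2.2 : Eucl d) i) continuous_const (by fun_prop))
  convert (hK.isCompact.image continuous_fst).isClosed using 1
  ext x
  simp [gapSet]

/-- If `x - x'` is a positive multiple of the `i`-th basis vector, monotonicity orders the `i`-th
coordinates of all values over `x` and `x'`, which contradicts the gap from `a` to `b`. Hence the
translates along that vector are disjoint, and infinitely many of them by bounded amounts force
measure zero. -/
lemma volume_image_gapSet [CompactSpace Ω] {Γ : Set (Ω × Ω)} (hΓ : IsClosed Γ)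
    (hmono : MonotoneGraph Γ) (i : Fin d) {a b : ℝ} (hab : a < b) :
    volume (Subtype.val '' gapSet Γ i a b : Set (Eucl d)) = 0 := by
  set e : Eucl d := EuclideanSpace.single i 1
  have hbdd : Bornology.IsBounded (Set.range fun n : ℕ => (1 / ((n : ℝ) + 1)) • e) :=
    Metric.isBounded_range_of_tendsto _
      (tendsto_one_div_add_atTop_nhds_zero_nat.smul_const e)
  have key : ∀ s t : ℝ, s < t → ∀ x x' : Ω, x ∈ gapSet Γ i a b → x' ∈ gapSet Γ i a b →
      s • e + (x : Eucl d) = t • e + x' → False := by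
    rintro s t hst x x' ⟨y, -, hy, -, hya, -⟩ ⟨-, y', -, hy', -, hyb⟩ h
    have h1 := hmono _ hy _ hy'
    have h2 : (x : Eucl d) - x' = (t - s) • e := by
      rw [sub_smul, sub_eq_sub_iff_add_eq_add, add_comm, h]
    have h3 : inner ℝ e ((y : Eucl d) - y') = (y : Eucl d) i - (y' : Eucl d) i := by
      simp [e, EuclideanSpace.inner_single_left]
    rw [h2, real_inner_smul_left, h3] at h1
    nlinarith [mul_pos (sub_pos.2 hst) (sub_pos.2 hab)]
  refine Measure.addHaar_eq_zero_of_disjoint_translates volume _ hbdd ?_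
    ((isClosed_gapSet hΓ i a b).isCompact.image continuous_subtype_val).measurableSet
  have hanti : StrictAnti fun n : ℕ => (1 / ((n : ℝ) + 1)) := fun m n hmn => by
    simp only
    gcongr
  intro m n hmn
  refine Set.disjoint_left.2 ?_
  rintro z hz hz'
  simp only [Set.singleton_add, Set.mem_image, exists_exists_and_eq_and] at hz hz'
  obtain ⟨x, hx, rfl⟩ := hz
  obtain ⟨x', hx', h⟩ := hz'
  rcases lt_or_gt_of_ne hmn with hlt | hlt
  · exact key _ _ (hanti hlt) x' x hx' hx h
  · exact key _ _ (hanti hlt) x x' hx hx' h.symm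

/-- The points at which `Γ` is multivalued, as a countable union of closed sets. -/
def multiSet (Γ : Set (Ω × Ω)) : Set Ω :=
  ⋃ (i : Fin d) (a : ℚ) (b : ℚ) (_ : a < b), gapSet Γ i a b

lemma measurableSet_multiSet [CompactSpace Ω] {Γ : Set (Ω × Ω)} (hΓ : IsClosed Γ) :
    MeasurableSet (multiSet Γ) :=
  .iUnion fun i => .iUnion fun a => .iUnion fun b => .iUnion fun _ =>
    (isClosed_gapSet hΓ i a b).measurableSet

lemma measure_multiSet [CompactSpace Ω] {Γ : Set (Ω × Ω)} (hΓ : IsClosed Γ)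
    (hmono : MonotoneGraph Γ) {ρ : Measure Ω} (hρ : ρ.map (Subtype.val : Ω → Eucl d) ≪ volume) :
    ρ (multiSet Γ) = 0 := by
  simp only [multiSet, measure_iUnion_null_iff]
  intro i a b hab
  refine measure_mono_null (Set.subset_preimage_image Subtype.val _) ?_
  exact Measure.preimage_null_of_map_null measurable_subtype_coe.aemeasurable
    (hρ (volume_image_gapSet hΓ hmono i (by exact_mod_cast hab)))

lemma eq_of_notMem_multiSet {Γ : Set (Ω × Ω)} {x y y' : Ω} (hx : x ∉ multiSet Γ)
    (hy : (x, y) ∈ Γ) (hy' : (x, y') ∈ Γ) : y = y' := by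
  have key : ∀ z z' : Ω, (x, z) ∈ Γ → (x, z') ∈ Γ → ∀ i, (z' : Eucl d) i ≤ (z : Eucl d) i := by
    intro z z' hz hz' i
    by_contra! hlt
    obtain ⟨a, ha, ha'⟩ := exists_rat_btwn hlt
    obtain ⟨b, hb, hb'⟩ := exists_rat_btwn ha'
    refine hx ?_
    simp only [multiSet, Set.mem_iUnion]
    exact ⟨i, a, b, by exact_mod_cast hb, z, z', hz, hz', ha.le, hb'.le⟩
  ext i
  exact (key _ _ hy' hy i).antisymm (key _ _ hy hy' i)

/-! ### Borel selection and Brenier's theorem. -/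

/-- A closed set in `Ω × Ω` is the graph of a Borel map away from its multivalued points. -/
lemma exists_measurable_selection [CompactSpace Ω] [Nonempty Ω] {Γ : Set (Ω × Ω)}
    (hΓ : IsClosed Γ) :
    ∃ T : BorelMap Ω, ∀ p ∈ Γ, p.1 ∉ multiSet Γ → T.1 p.1 = p.2 := by
  classical
  obtain ⟨y₀⟩ := ‹Nonempty Ω›
  have hproj : ∀ C : Set Ω, IsClosed C →
      MeasurableSet (Prod.fst '' (Γ ∩ Prod.snd ⁻¹' C) : Set Ω) := fun C hC =>
    ((hΓ.inter (hC.preimage continuous_snd)).isCompact.image continuous_fst).measurableSet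
  set X : Set Ω := Prod.fst '' (Γ ∩ Prod.snd ⁻¹' Set.univ) \ multiSet Γ
  have hX : MeasurableSet X := MeasurableSet.diff (hproj _ isClosed_univ) (measurableSet_multiSet hΓ)
  have hex : ∀ x ∈ X, ∃ y, (x, y) ∈ Γ := by
    rintro x ⟨⟨p, ⟨hp, -⟩, rfl⟩, -⟩
    exact ⟨p.2, hp⟩
  let T : Ω → Ω := fun x => if h : x ∈ X then (hex x h).choose else y₀
  have hT : ∀ p ∈ Γ, p.1 ∉ multiSet Γ → T p.1 = p.2 := by
    intro p hp hpm
    have hpX : p.1 ∈ X := ⟨⟨p, ⟨hp, trivial⟩, rfl⟩, hpm⟩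
    simp only [T, hpX, dif_pos]
    exact eq_of_notMem_multiSet hpm (hex _ hpX).choose_spec hp
  refine ⟨⟨T, measurable_of_isClosed fun C hC => ?_⟩, hT⟩
  -- On `X` the value is unique, so the preimage of `C` is a projection of a compact set; off `X`
  -- the map is the constant `y₀`.
  have : T ⁻¹' C = (X ∩ Prod.fst '' (Γ ∩ Prod.snd ⁻¹' C)) ∪ (Xᶜ ∩ {_x | y₀ ∈ C}) := by
    ext x
    by_cases hx : x ∈ X
    · simp only [Set.mem_preimage, Set.mem_union, Set.mem_inter_iff, hx, true_and,
        Set.mem_compl_iff, not_true, false_and, or_false]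
      constructor
      · intro h
        have h1 : T x = (hex x hx).choose := by simp only [T, hx, dif_pos]
        exact ⟨(x, T x), ⟨h1 ▸ (hex x hx).choose_spec, h⟩, rfl⟩
      · rintro ⟨p, ⟨hp, hpC⟩, rfl⟩
        rw [hT p hp hx.2]
        exact hpC
    · simp [hx, T]
  rw [this]
  exact (hX.inter (hproj C hC)).union (hX.compl.inter (.const _))

/-- **Brenier's theorem** on a compact set: from an absolutely continuous measure there is a Borel
map whose cost is the squared Wasserstein distance and whose graph is monotone. -/
lemma exists_monotone_map [CompactSpace Ω] {ρ : ProbabilityMeasure Ω}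
    (hρ : (ρ : Measure Ω).map (Subtype.val : Ω → Eucl d) ≪ volume) (ν : ProbabilityMeasure Ω) :
    ∃ (T : BorelMap Ω) (Γ : Set (Ω × Ω)), push T ρ = ν ∧ mapCost ρ T = wassersteinSq ρ ν ∧
      MeasurableSet Γ ∧ MonotoneGraph Γ ∧ ∀ᵐ x ∂(ρ : Measure Ω), (x, T.1 x) ∈ Γ := by
  have := ρ.nonempty
  obtain ⟨γ, hγ, hmin, hcost⟩ := exists_optimal_plan ρ ν
  set Γ := (γ : Measure (Ω × Ω)).support
  have hΓ : IsClosed Γ := Measure.isClosed_support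
  have hmono : MonotoneGraph Γ := fun p hp q hq => inner_nonneg_of_mem_support hγ hmin hp hq
  obtain ⟨T, hT⟩ := exists_measurable_selection hΓ
  have hTm := T.2
  have hnull : ∀ᵐ p ∂(γ : Measure (Ω × Ω)), p.1 ∉ multiSet Γ := by
    refine ae_of_ae_map (f := Prod.fst) (p := fun x => x ∉ multiSet Γ)
      measurable_fst.aemeasurable ?_
    rw [hγ.1]
    exact measure_eq_zero_iff_ae_notMem.1 (measure_multiSet hΓ hmono hρ)
  -- The plan lives on its support and does not charge the multivalued points, so it is concentrated
  -- on the graph of `T`.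
  have hgraph : ∀ᵐ p ∂(γ : Measure (Ω × Ω)), T.1 p.1 = p.2 := by
    filter_upwards [hnull, Measure.support_mem_ae] with p hp hpΓ using hT p hpΓ hp
  refine ⟨T, Γ, ?_, ?_, hΓ.measurableSet, hmono, ?_⟩
  · apply ProbabilityMeasure.toMeasure_injective
    rw [push, ProbabilityMeasure.toMeasure_map, ← hγ.1, ← hγ.2,
      Measure.map_map hTm measurable_fst]
    exact Measure.map_congr hgraph
  · rw [← hcost, mapCost, planCost, ← hγ.1, integral_map measurable_fst.aemeasurable]
    · refine integral_congr_ae ?_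
      filter_upwards [hgraph] with p hp
      rw [hp, norm_sub_rev]
    · exact (Measurable.aestronglyMeasurable (by fun_prop))
  · rw [← hγ.1, ae_map_iff measurable_fst.aemeasurable]
    · filter_upwards [hgraph, Measure.support_mem_ae] with p hp hpΓ
      rw [hp]
      exact hpΓ
    · exact (measurable_id.prodMk hTm) hΓ.measurableSet

/-! ### Lower bound for the kinetic energy. -/

lemma ofReal_mapCost [CompactSpace Ω] (ρ : ProbabilityMeasure Ω) (T : BorelMap Ω) :
    ENNReal.ofReal (mapCost ρ T) =
      ∫⁻ x, ‖(T.1 x : Eucl d) - (x : Eucl d)‖ₑ ^ 2 ∂(ρ : Measure Ω) := by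
  have hT := T.2
  have hint : Integrable (sqCost : Ω × Ω → ℝ) ((ρ : Measure Ω).map fun x => (T.1 x, x)) := by
    have : IsProbabilityMeasure ((ρ : Measure Ω).map fun x => (T.1 x, x)) :=
      Measure.isProbabilityMeasure_map (by fun_prop)
    exact continuous_sqCost.integrable_of_hasCompactSupport (HasCompactSupport.of_compactSpace _)
  have hint' : Integrable (fun x => ‖(T.1 x : Eucl d) - (x : Eucl d)‖ ^ 2) (ρ : Measure Ω) :=
    hint.comp_measurable (by fun_prop)
  rw [mapCost, ofReal_integral_eq_lintegral_ofReal hint' (.of_forall fun x => by positivity)]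
  refine lintegral_congr fun x => ?_
  rw [ENNReal.ofReal_pow (norm_nonneg _), ofReal_norm]

lemma sq_lintegral_le_lintegral_sq {α : Type*} [MeasurableSpace α] (μ : Measure α)
    [IsProbabilityMeasure μ] {f : α → ℝ≥0∞} (hf : AEMeasurable f μ) :
    (∫⁻ a, f a ∂μ) ^ 2 ≤ ∫⁻ a, f a ^ 2 ∂μ := by
  have h := ENNReal.lintegral_mul_le_Lp_mul_Lq μ (Real.HolderConjugate.two_two) hf
    (g := fun _ => 1) aemeasurable_const
  simp only [Pi.mul_apply, mul_one, ENNReal.one_rpow, lintegral_const, measure_univ] at h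
  calc (∫⁻ a, f a ∂μ) ^ 2 ≤ ((∫⁻ a, f a ^ (2 : ℝ) ∂μ) ^ (1 / 2 : ℝ)) ^ 2 := by gcongr
    _ = ∫⁻ a, f a ^ 2 ∂μ := by
      rw [← ENNReal.rpow_natCast, ← ENNReal.rpow_mul]
      norm_num

namespace FlowCompetitor

variable {ρ : ProbabilityMeasure Ω}

lemma measurable_v_φ (c : FlowCompetitor ρ) :
    Measurable fun z : ℝ × Ω => c.v z.1 (c.φ z.1 z.2) :=
  c.measurable_v.comp (measurable_fst.prodMk c.measurable_φ)

lemma energy_eq (c : FlowCompetitor ρ) :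
    c.energy = ∫⁻ t in Set.Icc (0 : ℝ) 1, ∫⁻ x, ‖c.v t (c.φ t x)‖ₑ ^ 2 ∂(ρ : Measure Ω) := by
  refine lintegral_congr fun t => lintegral_map ?_ (c.measurable_φ.comp measurable_prodMk_left)
  exact (c.measurable_v.comp measurable_prodMk_left).enorm.pow_const 2

/-- The kinetic energy of a flow is at least the transport cost of its time-one map. -/
lemma mapCost_le_energy [CompactSpace Ω] (c : FlowCompetitor ρ) :
    ENNReal.ofReal (mapCost ρ c.T) ≤ c.energy := by
  rw [ofReal_mapCost, c.energy_eq, lintegral_lintegral_swap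
    (c.measurable_v_φ.enorm.pow_const 2).aemeasurable]
  refine lintegral_mono_ae ?_
  filter_upwards [c.flow] with x hx
  have h1 : (c.T.1 x : Eucl d) - x = ∫ s in Set.Icc (0 : ℝ) 1, c.v s (c.φ s x) := by
    rw [c.time_one, hx 1 (by simp), add_sub_cancel_left,
      intervalIntegral.integral_of_le zero_le_one, integral_Icc_eq_integral_Ioc]
  -- Unit mass of the time interval makes the Cauchy–Schwarz constant equal to one.
  have : IsProbabilityMeasure (volume.restrict (Set.Icc (0 : ℝ) 1)) := ⟨by simp⟩
  rw [h1]
  calc _ ≤ (∫⁻ s in Set.Icc (0 : ℝ) 1, ‖c.v s (c.φ s x)‖ₑ) ^ 2 := by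
        gcongr; exact enorm_integral_le_lintegral_enorm _
    _ ≤ _ := sq_lintegral_le_lintegral_sq _
        (c.measurable_v_φ.comp measurable_prodMk_right).enorm.aemeasurable

end FlowCompetitor

/-! ### Displacement interpolation and its velocity field. -/

/-- The displacement interpolation `(1 - t) x + t T x` between the identity and `T`. -/
def interp (T : BorelMap Ω) (t : ℝ) (x : Ω) : Eucl d :=
  (x : Eucl d) + t • ((T.1 x : Eucl d) - x)

lemma measurable_interp (T : BorelMap Ω) : Measurable (Function.uncurry (interp T)) := by
  have hT := T.2
  unfold interp Function.uncurry
  fun_prop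

/-- Trajectories of a monotone displacement interpolation do not meet before time one. -/
lemma interp_injective {T : BorelMap Ω} {Γ : Set (Ω × Ω)} (hmono : MonotoneGraph Γ) {t : ℝ}
    (h0 : 0 ≤ t) (h1 : t < 1) {x x' : Ω} (hx : (x, T.1 x) ∈ Γ) (hx' : (x', T.1 x') ∈ Γ)
    (h : interp T t x = interp T t x') : x = x' := by
  have hm := hmono _ hx _ hx'
  simp only at hm
  have h2 : (1 - t) • ((x : Eucl d) - x') + t • ((T.1 x : Eucl d) - T.1 x') = 0 := by
    rw [← sub_eq_zero.2 h]
    simp only [interp]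
    module
  -- Pairing with `x - x'` gives a vanishing sum of two non-negative terms, in which `‖x - x'‖²` has
  -- the positive weight `1 - t`.
  have h3 := congrArg (inner ℝ ((x : Eucl d) - x')) h2
  rw [inner_add_right, real_inner_smul_right, real_inner_smul_right, inner_zero_right,
    real_inner_self_eq_norm_sq] at h3
  have h4 : ‖(x : Eucl d) - x'‖ ^ 2 = 0 := by
    have := sq_nonneg ‖(x : Eucl d) - x'‖
    nlinarith [mul_nonneg h0 hm, mul_nonneg (sub_nonneg.2 h1.le) this]
  exact Subtype.ext (sub_eq_zero.1 (norm_eq_zero.1 (pow_eq_zero_iff two_ne_zero |>.1 h4)))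

/-- A Borel velocity field that generates a monotone displacement interpolation. -/
lemma exists_velocity [CompactSpace Ω] {T : BorelMap Ω} {Γ : Set (Ω × Ω)} (hΓ : MeasurableSet Γ)
    (hmono : MonotoneGraph Γ) :
    ∃ v : ℝ → Eucl d → Eucl d, Measurable (Function.uncurry v) ∧
      ∀ t ∈ Set.Ico (0 : ℝ) 1, ∀ x : Ω, (x, T.1 x) ∈ Γ →
        v t (interp T t x) = (T.1 x : Eucl d) - x := by
  have hT := T.2
  have : PolishSpace Ω := inferInstance
  set Z : Set (ℝ × Ω) := Set.Ico (0 : ℝ) 1 ×ˢ {x | (x, T.1 x) ∈ Γ}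
  have hZ : MeasurableSet Z := measurableSet_Ico.prod ((measurable_id.prodMk hT) hΓ)
  have := hZ.standardBorel
  let f : Z → ℝ × Eucl d := fun z => (z.1.1, interp T z.1.1 z.1.2)
  have hf : Measurable f :=
    (measurable_fst.comp measurable_subtype_coe).prodMk
      ((measurable_interp T).comp measurable_subtype_coe)
  have hinj : Function.Injective f := by
    rintro ⟨⟨t, x⟩, ht, hx⟩ ⟨⟨t', x'⟩, ht', hx'⟩ h
    simp only [f, Prod.mk.injEq] at h
    obtain ⟨rfl, h⟩ := h
    have := interp_injective hmono ht.1 ht.2 hx hx' h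
    subst this
    rfl
  -- Lusin–Souslin: an injective Borel map on a standard Borel space has Borel images, so extending
  -- the velocity by zero off the trajectories keeps it Borel.
  have hemb := hf.measurableEmbedding hinj
  let g : Z → Eucl d := fun z => (T.1 z.1.2 : Eucl d) - z.1.2
  have hg : Measurable g := by fun_prop
  refine ⟨fun t y => Function.extend f g 0 (t, y),
    hemb.measurable_extend hg measurable_const, fun t ht x hx => ?_⟩
  exact hinj.extend_apply g 0 ⟨(t, x), ht, hx⟩

/-- Every `ν` is reached from an absolutely continuous `ρ` by a flow whose energy and whose
time-one map both attain the squared Wasserstein distance. -/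
lemma exists_optimal_flow [CompactSpace Ω] {ρ : ProbabilityMeasure Ω}
    (hρ : (ρ : Measure Ω).map (Subtype.val : Ω → Eucl d) ≪ volume) (ν : ProbabilityMeasure Ω) :
    ∃ c : FlowCompetitor ρ, push c.T ρ = ν ∧ mapCost ρ c.T = wassersteinSq ρ ν ∧
      c.energy = ENNReal.ofReal (mapCost ρ c.T) := by
  obtain ⟨T, Γ, hpush, hcost, hΓ, hmono, hae⟩ := exists_monotone_map hρ ν
  obtain ⟨v, hv, hvT⟩ := exists_velocity (T := T) hΓ hmono
  -- Trajectories may meet at time one, where `v` is not prescribed; that single time is null.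
  have hvae : ∀ x : Ω, (x, T.1 x) ∈ Γ → ∀ᵐ s : ℝ, s ∈ Set.Icc (0 : ℝ) 1 →
      v s (interp T s x) = (T.1 x : Eucl d) - x := by
    intro x hx
    filter_upwards [compl_mem_ae_iff.2 (measure_singleton (1 : ℝ))] with s hs1 hs
    exact hvT s ⟨hs.1, lt_of_le_of_ne hs.2 hs1⟩ x hx
  have hvint : ∀ x : Ω, (x, T.1 x) ∈ Γ → ∀ t ∈ Set.Icc (0 : ℝ) 1, ∀ᵐ s : ℝ, s ∈ Set.uIoc 0 t →
      v s (interp T s x) = (T.1 x : Eucl d) - x := by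
    intro x hx t ht
    filter_upwards [hvae x hx] with s hs hst
    rw [Set.uIoc_of_le ht.1] at hst
    exact hs ⟨hst.1.le, hst.2.trans ht.2⟩
  let c : FlowCompetitor ρ :=
    { v := v
      φ := interp T
      T := T
      measurable_v := hv
      measurable_φ := measurable_interp T
      integrable := by
        filter_upwards [hae] with x hx
        refine (intervalIntegrable_const (c := (T.1 x : Eucl d) - x)).congr_ae ?_
        refine (ae_restrict_iff' measurableSet_uIoc).2 ?_
        filter_upwards [hvint x hx 1 (by simp)] with s hs hs' using (hs hs').symm
      flow := by
        filter_upwards [hae] with x hx t ht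
        rw [intervalIntegral.integral_congr_ae (hvint x hx t ht)]
        simp only [interp, intervalIntegral.integral_const, sub_zero]
      time_one := fun x => by simp [interp] }
  refine ⟨c, hpush, hcost, ?_⟩
  have hTm := T.2
  rw [c.energy_eq, ofReal_mapCost, lintegral_lintegral_swap
    (c.measurable_v_φ.enorm.pow_const 2).aemeasurable]
  refine lintegral_congr_ae ?_
  filter_upwards [hae] with x hx
  have : ∫⁻ s in Set.Icc (0 : ℝ) 1, ‖c.v s (c.φ s x)‖ₑ ^ 2 =
      ∫⁻ _s in Set.Icc (0 : ℝ) 1, ‖(T.1 x : Eucl d) - x‖ₑ ^ 2 := by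
    refine setLIntegral_congr_fun_ae measurableSet_Icc ?_
    filter_upwards [hvae x hx] with s hs hs'
    rw [← hs hs']
  rw [this]
  simp [c]

/-! ### Existence for the relaxed problem and comparison of the two objectives. -/

section Minimizers

variable {𝓕 : Type*} (𝓛 : 𝓕 → ProbabilityMeasure Ω → ℝ) {τ : ℝ} {ρ : ProbabilityMeasure Ω}

/-- The static problem relaxed to plans has a solution. -/
lemma exists_relaxed_minimizer [CompactSpace Ω] [TopologicalSpace 𝓕] [CompactSpace 𝓕] [Nonempty 𝓕]
    (h𝓛 : Continuous (Function.uncurry 𝓛)) (hτ : 0 < τ) :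
    ∃ (ν : ProbabilityMeasure Ω) (F : 𝓕), ∀ (T : BorelMap Ω) (G : 𝓕),
      𝓛 F ν + 1 / (2 * τ) * wassersteinSq ρ ν ≤ objective 𝓛 τ ρ T G := by
  -- Only the first marginal is fixed; the second marginal is the unknown target.
  set K : Set (ProbabilityMeasure (Ω × Ω)) :=
    {γ | γ.map (f := Prod.fst) measurable_fst.aemeasurable = ρ}
  have hK : IsClosed K :=
    isClosed_eq (ProbabilityMeasure.continuous_map continuous_fst) continuous_const
  have hsnd : Continuous fun γ : ProbabilityMeasure (Ω × Ω) =>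
      γ.map (f := Prod.snd) measurable_snd.aemeasurable :=
    ProbabilityMeasure.continuous_map continuous_snd
  have hmem : ∀ T : BorelMap Ω, graphPlan ρ T ∈ K := fun T => by
    apply ProbabilityMeasure.toMeasure_injective
    rw [ProbabilityMeasure.toMeasure_map]
    exact (graphPlan_mem_couplings ρ T).1
  have hcont : Continuous fun z : 𝓕 × ProbabilityMeasure (Ω × Ω) =>
      𝓛 z.1 (z.2.map (f := Prod.snd) measurable_snd.aemeasurable) +
        1 / (2 * τ) * planCost z.2 :=
    (h𝓛.comp (continuous_fst.prodMk (hsnd.comp continuous_snd))).add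
      (continuous_const.mul (continuous_planCost.comp continuous_snd))
  obtain ⟨G₀⟩ := ‹Nonempty 𝓕›
  obtain ⟨⟨F, γ⟩, ⟨-, hγ⟩, hmin⟩ := (isCompact_univ.prod hK.isCompact).exists_isMinOn
    ⟨(G₀, graphPlan ρ ⟨id, measurable_id⟩), trivial, hmem _⟩ hcont.continuousOn
  have hτ' : 0 ≤ 1 / (2 * τ) := by positivity
  have hγν : γ ∈ couplings ρ (γ.map (f := Prod.snd) measurable_snd.aemeasurable) :=
    ⟨congrArg ProbabilityMeasure.toMeasure hγ, rfl⟩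
  have hpush : ∀ T : BorelMap Ω,
      (graphPlan ρ T).map (f := Prod.snd) measurable_snd.aemeasurable = push T ρ := fun T =>
    ProbabilityMeasure.toMeasure_injective (by
      rw [ProbabilityMeasure.toMeasure_map]; exact (graphPlan_mem_couplings ρ T).2)
  refine ⟨_, F, fun T G => (add_le_add_right
    (mul_le_mul_of_nonneg_left (wassersteinSq_le hγν) hτ') _).trans ?_⟩
  have h := isMinOn_iff.1 hmin (G, graphPlan ρ T) ⟨trivial, hmem T⟩
  rwa [planCost_graphPlan, hpush] at h

lemma dynObjective_eq (h𝓛 : ∀ F μ, 0 ≤ 𝓛 F μ) (hτ : 0 < τ) {c : FlowCompetitor ρ}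
    (hc : c.energy = ENNReal.ofReal (mapCost ρ c.T)) (F : 𝓕) :
    dynObjective 𝓛 τ c F = ENNReal.ofReal (objective 𝓛 τ ρ c.T F) := by
  have h0 : 0 ≤ mapCost ρ c.T := integral_nonneg fun x => by positivity
  rw [dynObjective, objective, hc, ENNReal.ofReal_add (h𝓛 _ _) (by positivity),
    ENNReal.ofReal_mul (by positivity)]

lemma objective_le_dynObjective [CompactSpace Ω] (h𝓛 : ∀ F μ, 0 ≤ 𝓛 F μ) (hτ : 0 < τ)
    (c : FlowCompetitor ρ) (F : 𝓕) :
    ENNReal.ofReal (objective 𝓛 τ ρ c.T F) ≤ dynObjective 𝓛 τ c F := by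
  have h0 : 0 ≤ mapCost ρ c.T := integral_nonneg fun x => by positivity
  rw [dynObjective, objective, ENNReal.ofReal_add (h𝓛 _ _) (by positivity),
    ENNReal.ofReal_mul (by positivity)]
  gcongr
  exact c.mapCost_le_energy

end Minimizers

end ModuleWise

end

theorem proposition2 {d : ℕ} {Ω : Set (ModuleWise.Eucl d)}
    (hΩ_convex : Convex ℝ Ω) (hΩ_compact : IsCompact Ω) (hΩ_frontier : volume (frontier Ω) = 0)
    {𝓕 : Type*} [TopologicalSpace 𝓕] [CompactSpace 𝓕] [Nonempty 𝓕]
    (𝓛 : 𝓕 → ProbabilityMeasure Ω → ℝ)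
    (h𝓛_cont : Continuous (Function.uncurry 𝓛)) (h𝓛_nonneg : ∀ F μ, 0 ≤ 𝓛 F μ)
    (τ : ℝ) (hτ : 0 < τ)
    (ρ : ProbabilityMeasure Ω)
    (hρ : (ρ : Measure Ω).map (Subtype.val : Ω → ModuleWise.Eucl d) ≪ volume) :
    -- the static problem
    (∃ (T : ModuleWise.BorelMap Ω) (F : 𝓕), ModuleWise.IsMinimizer 𝓛 τ ρ T F ∧
      ModuleWise.IsOptimalTransportMap ρ (ModuleWise.push T ρ) T) ∧
    (∀ (T : ModuleWise.BorelMap Ω) (F : 𝓕), ModuleWise.IsMinimizer 𝓛 τ ρ T F →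
      ModuleWise.IsOptimalTransportMap ρ (ModuleWise.push T ρ) T) ∧
    -- the dynamic problem
    (∃ (c : ModuleWise.FlowCompetitor ρ) (F : 𝓕), ModuleWise.IsDynMinimizer 𝓛 τ c F ∧
      ModuleWise.IsOptimalTransportMap ρ (ModuleWise.push c.T ρ) c.T) ∧
    (∀ (c : ModuleWise.FlowCompetitor ρ) (F : 𝓕), ModuleWise.IsDynMinimizer 𝓛 τ c F →
      ModuleWise.IsOptimalTransportMap ρ (ModuleWise.push c.T ρ) c.T) := by
  open ModuleWise in
  have : CompactSpace Ω := isCompact_iff_compactSpace.1 hΩ_compact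
  have hτ' : 0 < 1 / (2 * τ) := by positivity
  obtain ⟨ν, F, hmin⟩ := exists_relaxed_minimizer 𝓛 (ρ := ρ) h𝓛_cont hτ
  -- One flow to the relaxed optimal target solves both problems.
  obtain ⟨c, rfl, hcost, hc⟩ := exists_optimal_flow hρ ν
  rw [← hcost] at hmin
  have hopt := isOptimalTransportMap_of_le hcost.le
  refine ⟨⟨c.T, F, hmin, hopt⟩, fun T G hT => ?_, ⟨c, F, fun c' G => ?_, hopt⟩, fun c₁ G hc₁ => ?_⟩
  -- The competitor has the same target and the same `G`, so the losses cancel and only the costs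
  -- are compared.
  · obtain ⟨c', hpush, hcost', -⟩ := exists_optimal_flow hρ (push T ρ)
    refine isOptimalTransportMap_of_le ?_
    have h := hT c'.T G
    rw [objective, objective, hpush, hcost', add_le_add_iff_left] at h
    exact le_of_mul_le_mul_left h hτ'
  · rw [dynObjective_eq 𝓛 h𝓛_nonneg hτ hc]
    exact (ENNReal.ofReal_le_ofReal (hmin c'.T G)).trans
      (objective_le_dynObjective 𝓛 h𝓛_nonneg hτ c' G)
  · obtain ⟨c', hpush, hcost', hc'⟩ := exists_optimal_flow hρ (push c₁.T ρ)
    refine isOptimalTransportMap_of_le ?_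
    -- The static objective of `c₁` is at most its dynamic one, and for `c'` the two agree, so
    -- minimality descends to the static comparison.
    have h := (objective_le_dynObjective 𝓛 h𝓛_nonneg hτ c₁ G).trans (hc₁ c' G)
    have h0 : 0 ≤ objective 𝓛 τ ρ c'.T G :=
      add_nonneg (h𝓛_nonneg _ _) (mul_nonneg hτ'.le (integral_nonneg fun x => by positivity))
    rw [dynObjective_eq 𝓛 h𝓛_nonneg hτ hc', ENNReal.ofReal_le_ofReal_iff h0, objective, objective,
      hpush, hcost', add_le_add_iff_left] at h
    exact le_of_mul_le_mul_left h hτ'
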